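/- Theorem 1. For every constant $c$ there are constants $d$ and $C$, depending only on $c$, such that the following holds for every $n\ge 1$. Consider a congested clique with $n$ nodes (synchronous rounds; in each round every node may send a separate message of $d(\lfloor\log_2 n\rfloor+1)$ bits to every other node and perform unlimited local computation). Each node holds a batch of $n$ points of the Euclidean plane, all $n^2$ points being distinct, and each coordinate is given by a word of $c(\lfloor\log_2 n\rfloor+1)$ bits in a fixed number format known to all nodes. Let $S$ be the set of the $n^2$ points, let $h$ be the number of vertices of the convex hull of $S$, and let $p_{\min}$ and $p_{\max}$ be the leftmost and the rightmost point of $S$ (the lowest leftmost and the highest rightmost one, in case of ties). QuickConvexHull$(S)$ calls QuickUpperHull$(p_{\min},p_{\max})$ and then QuickLowerHull$(p_{\min},p_{\max})$. QuickUpperHull$(p,r)$ considers the points of $S$ with $x$-coordinates between those of $p$ and $r$ that lie strictly above the segment $pr$. If there are none, the call is a leaf. Otherwise it finds such a point $q$ of maximum height above the segment $pr$ (in case of ties, the leftmost one), and calls QuickUpperHull$(p,q)$ and then QuickUpperHull$(q,r)$. QuickLowerHull is defined symmetrically, with "below" in place of "above" (ties again being resolved in favour of the leftmost point). Then there is an algorithm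 on this congested clique that executes QuickConvexHull$(S)$ and computes the convex hull of $S$ in at most $C\cdot h$ rounds: at the end, the vertices of the hull, in clockwise order starting from $p_{\min}$, are held by consecutive nodes in batches of $n$ vertices (but for the last batch). The algorithm executes the recursive calls one after the other in depth-first order. It spends at most $C$ rounds on each call (not counting the calls made by it), at most $C$ rounds before the first call, and at most $C$ rounds after the last call. The points $q$ found by the non-leaf calls are pairwise distinct vertices of the convex hull of $S$, different from $p_{\min}$ and $p_{\max}$, and together with $p_{\min}$ and $p_{\max}$ they are all the vertices of the hull. -/

import Mathlib

/-! ## The congested clique -/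

/-- A word (message, or coordinate) of `b` bits. -/
abbrev Word (b : ℕ) : Type := Fin b → Bool

/-- The number of bits of the binary representation of `n ≥ 1`, i.e. `⌊log₂ n⌋ + 1`.
`O(log n)` bits means `c * bitLength n` bits for a constant `c`. -/
def bitLength (n : ℕ) : ℕ := Nat.log 2 n + 1

/-- A deterministic algorithm on the congested clique with `n` nodes and messages of `b` bits.
Local computation is unlimited: the local functions are arbitrary. A node knows its own
identifier and its own input only. In a round, each node sends a message of `b` bits to each
node (the message to itself is immaterial), and updates its state from the messages received.
`output` is `none` as long as the node has not terminated. -/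
structure CliqueAlgorithm (n b : ℕ) (Inp Out : Type) where
  State : Type
  init : Fin n → Inp → State
  send : Fin n → State → Fin n → Word b
  update : Fin n → State → (Fin n → Word b) → State
  output : Fin n → State → Option Out

namespace CliqueAlgorithm

variable {n b : ℕ} {Inp Out : Type}

/-- The state of each node after `t` rounds. -/
def run (A : CliqueAlgorithm n b Inp Out) (inp : Fin n → Inp) : ℕ → Fin n → A.State
  | 0, v => A.init v (inp v)
  | t + 1, v => A.update v (A.run inp t v) (fun u => A.send u (A.run inp t u) v)

/-- On input `inp`, each node `v` terminates after at most `R` rounds, with result `out v`. -/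
def ComputesIn (A : CliqueAlgorithm n b Inp Out) (inp : Fin n → Inp) (R : ℕ)
    (out : Fin n → Out) : Prop :=
  ∀ v, ∃ t ≤ R, (∀ s < t, A.output v (A.run inp s v) = none) ∧
    ∀ s, t ≤ s → A.output v (A.run inp s v) = some (out v)

end CliqueAlgorithm

/-! ## Planar geometry -/

/-- The Euclidean plane. -/
abbrev Plane : Type := EuclideanSpace ℝ (Fin 2)

/-- Twice the signed area of the triangle `p`, `r`, `q`: positive for a left (counterclockwise)
turn, negative for a right (clockwise) turn. -/
def cross (p r q : Plane) : ℝ :=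
  (r 0 - p 0) * (q 1 - p 1) - (r 1 - p 1) * (q 0 - p 0)

/-- Comparison of `x`-coordinates, ties being broken by the `y`-coordinates. -/
def LexLE (p q : Plane) : Prop := p 0 < q 0 ∨ (p 0 = q 0 ∧ p 1 ≤ q 1)

/-- `p` is the leftmost point of `S` (the lowest one of them). -/
def IsLeftmost (S : Set Plane) (p : Plane) : Prop := p ∈ S ∧ ∀ z ∈ S, LexLE p z

/-- `p` is the rightmost point of `S` (the highest one of them). -/
def IsRightmost (S : Set Plane) (p : Plane) : Prop := p ∈ S ∧ ∀ z ∈ S, LexLE z p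

/-- The vertices of the convex hull of `S`. -/
def hullVertices (S : Set Plane) : Set Plane := (convexHull ℝ S).extremePoints ℝ

/-- `l` lists the vertices of the convex hull of `S`, each exactly once, in clockwise order,
starting with the leftmost one. -/
def IsClockwiseHull (S : Set Plane) (l : List Plane) : Prop :=
  l.Nodup ∧ (∀ z, z ∈ l ↔ z ∈ hullVertices S) ∧ (∃ p ∈ l.head?, IsLeftmost S p) ∧
    ∀ i j k : Fin l.length, i < j → j < k → cross (l.get i) (l.get j) (l.get k) < 0

/-! ## The recursive procedures `QuickUpperHull` and `QuickLowerHull` -/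

/-- Which of the two recursive procedures is called. -/
inductive Side where
  | upper
  | lower

/-- For `p` left of `r`: the height of `q` above (for the upper hull) or below (for the lower
hull) the line `p r`, up to the positive factor `r 0 - p 0`. -/
def height : Side → Plane → Plane → Plane → ℝ
  | .upper, p, r, q => cross p r q
  | .lower, p, r, q => -cross p r q

/-- The points of `S` that lie strictly above (respectively below) the segment from `p` to
`r`. -/
def candidates (S : Set Plane) (s : Side) (p r : Plane) : Set Plane :=
  {q | q ∈ S ∧ p 0 ≤ q 0 ∧ q 0 ≤ r 0 ∧ 0 < height s p r q}

/-- `q` is the point selected by the call with end points `p` and `r`: a candidate of maximum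
height over the segment from `p` to `r`, and the leftmost of these. -/
def IsPivot (S : Set Plane) (s : Side) (p r q : Plane) : Prop :=
  q ∈ candidates S s p r ∧ ∀ z ∈ candidates S s p r,
    height s p r z < height s p r q ∨ (height s p r z = height s p r q ∧ LexLE q z)

/-- A call `QuickUpperHull(p, r)` or `QuickLowerHull(p, r)`. -/
structure Call where
  side : Side
  p : Plane
  r : Plane

/-- `QuickHull S s p r tr`: the execution of `QuickUpperHull(p, r)` (or `QuickLowerHull(p, r)`)
on the point set `S` is finite, and `tr` is the sequence of all calls in its recursion tree, in the
order in which they are activated, each with the point that it finds: `none` for a leaf. -/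
inductive QuickHull (S : Set Plane) (s : Side) :
    Plane → Plane → List (Call × Option Plane) → Prop
  | leaf (p r : Plane) (h : candidates S s p r = ∅) :
      QuickHull S s p r [(⟨s, p, r⟩, none)]
  | node (p r q : Plane) (l₁ l₂ : List (Call × Option Plane)) (h : IsPivot S s p r q)
      (h₁ : QuickHull S s p q l₁) (h₂ : QuickHull S s q r l₂) :
      QuickHull S s p r ((⟨s, p, r⟩, some q) :: (l₁ ++ l₂))

/-- `QuickConvexHull S tr`: `tr` is the sequence of all calls made on the point set `S`, first by
`QuickUpperHull(p_min, p_max)` and then by `QuickLowerHull(p_min, p_max)`. -/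
def QuickConvexHull (S : Set Plane) (tr : List (Call × Option Plane)) : Prop :=
  ∃ pmin pmax u l, IsLeftmost S pmin ∧ IsRightmost S pmax ∧
    QuickHull S .upper pmin pmax u ∧ QuickHull S .lower pmin pmax l ∧ tr = u ++ l

/-- The points found by the non-leaf calls, in the order in which they are found. -/
def foundPoints (tr : List (Call × Option Plane)) : List Plane := tr.filterMap Prod.snd

/-! ## The distributed problem -/

/-- The input of a node: a batch of `n` points, each given by two `b`-bit coordinates. -/
abbrev Batch (n b : ℕ) : Type := Fin n → Word b × Word b

/-- The `j`-th input point of node `v`, where `val` says which real number a `b`-bit word stands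
for. -/
def inputPoint {n b : ℕ} (val : Word b → ℝ) (inp : Fin n → Batch n b) (v j : Fin n) : Plane :=
  !₂[val (inp v j).1, val (inp v j).2]

/-- The set of all input points. -/
def inputSet {n b : ℕ} (val : Word b → ℝ) (inp : Fin n → Batch n b) : Set Plane :=
  {z | ∃ v j, z = inputPoint val inp v j}

/-- The list `l` held by consecutive nodes in batches of `n` items (but for the last batch). -/
def inBatches (n : ℕ) (l : List Plane) (v : Fin n) : List Plane :=
  (l.drop (v * n)).take n

/-- On input `inp` the algorithm executes the calls of `tr` one after the other, spending at least
one and at most `C` rounds on each of them (not counting its recursive calls), at most `C` rounds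
before the first call, and terminates at most `C` rounds after the last one with the results
`out`. Call number `i` is executed in the rounds from `T i` to `T (i + 1)`, and `active` shows which
call a node in a given state is working on. -/
def ExecutesCalls {n b : ℕ} {Inp Out : Type} (A : CliqueAlgorithm n b Inp Out)
    (active : Fin n → A.State → Option Call) (inp : Fin n → Inp) (C : ℕ)
    (tr : List (Call × Option Plane)) (out : Fin n → Out) : Prop :=
  ∃ T : ℕ → ℕ, T 0 ≤ C ∧ (∀ i < tr.length, T i < T (i + 1) ∧ T (i + 1) ≤ T i + C) ∧
    (∀ t < T 0, ∀ v, active v (A.run inp t v) = none) ∧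
    (∀ i : Fin tr.length, ∀ t, T i ≤ t → t < T (i + 1) →
      ∀ v, active v (A.run inp t v) = some (tr.get i).1) ∧
    (∀ t, T tr.length ≤ t → ∀ v, active v (A.run inp t v) = none) ∧
    A.ComputesIn inp (T tr.length + C) out

/-!
In the congested clique with unlimited local computation, one round suffices to find the best of
the `n ^ 2` points for any criterion known to all nodes: every node sends the best point of its own
batch to all nodes (`2 * c * bitLength n` bits, and one more bit to say that there is none), and the
best point overall is the best one of those received (`Query.answer_iUnion`). All nodes receive
the same messages, so all of them know the whole stack of pending calls and the trace of the calls
already executed (`Phase`). Two rounds find `p_min` and `p_max`, each call takes one round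
(`Phase.executes_of_quickHull`), and in the end every node reads off the hull from the trace.

The geometry rests on one notion, `OnChain`: a point of `S` is on the upper chain if it lies strictly
above every segment from a lexicographically smaller point of `S` to a larger one, and symmetrically
for the lower chain. The lexicographic order treats vertical segments and ties uniformly. The end
points of all calls are on their chain, as pivots are (`ChainPair.onChain_pivot`). Therefore no point
of `S` outside the vertical strip of a call is over its segment (`ChainPair.between`), so a pivot
maximizes a linear form over all of `S`, and with the tie-breaking rule it is a vertex of the hull
(`mem_hullVertices_of_lex_max`). Each pivot is strictly between the end points of its call, so the
recursion terminates and finds no point twice. Conversely each point of `S` lies vertically between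
the two chains of found points, hence in their convex hull, so there are no other vertices
(`mem_of_mem_hullVertices`). The clockwise order follows from `OnChain` as well: among three vertices,
the lexicographically middle one is strictly above or below the segment of the other two
(`isClockwiseHull_of_chains`). Finally, the recursion trees are full binary trees, so that there are at
most `2 * h` calls.
-/

/-! ### The lexicographic order of the plane -/

/-- The strict version of `LexLE`. -/
def LexLT (p q : Plane) : Prop := p 0 < q 0 ∨ (p 0 = q 0 ∧ p 1 < q 1)

theorem Plane.ext {p q : Plane} (h0 : p 0 = q 0) (h1 : p 1 = q 1) : p = q := by
  ext i
  fin_cases i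
  · exact h0
  · exact h1

theorem lexLT_trichotomy (p q : Plane) : LexLT p q ∨ p = q ∨ LexLT q p := by
  unfold LexLT
  rcases lt_trichotomy (p 0) (q 0) with h | h | h
  · exact Or.inl (Or.inl h)
  · rcases lt_trichotomy (p 1) (q 1) with h' | h' | h'
    · exact Or.inl (Or.inr ⟨h, h'⟩)
    · exact Or.inr (Or.inl (Plane.ext h h'))
    · exact Or.inr (Or.inr (Or.inr ⟨h.symm, h'⟩))
  · exact Or.inr (Or.inr (Or.inl h))

theorem LexLT.not_lexLE {p q : Plane} (h : LexLT p q) : ¬ LexLE q p := by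
  unfold LexLT LexLE at *
  grind

theorem lexLT_irrefl (p : Plane) : ¬ LexLT p p := by
  unfold LexLT
  grind

theorem LexLT.ne {p q : Plane} (h : LexLT p q) : p ≠ q := by
  rintro rfl
  exact lexLT_irrefl _ h

theorem LexLT.trans {p q r : Plane} (h : LexLT p q) (h' : LexLT q r) : LexLT p r := by
  unfold LexLT at *
  grind

theorem LexLT.lexLE {p q : Plane} (h : LexLT p q) : LexLE p q := by
  unfold LexLT LexLE at *
  grind

theorem lexLE_refl (p : Plane) : LexLE p p := Or.inr ⟨rfl, le_rfl⟩

theorem LexLE.eq_or_lexLT {p q : Plane} (h : LexLE p q) : p = q ∨ LexLT p q := by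
  rcases lexLT_trichotomy p q with h' | h' | h'
  · exact Or.inr h'
  · exact Or.inl h'
  · exact absurd h h'.not_lexLE

theorem LexLE.antisymm {p q : Plane} (h : LexLE p q) (h' : LexLE q p) : p = q :=
  h.eq_or_lexLT.resolve_right fun hlt => hlt.not_lexLE h'

theorem LexLT.fst_le {p q : Plane} (h : LexLT p q) : p 0 ≤ q 0 := by
  unfold LexLT at h
  grind

theorem LexLE.fst_le {p q : Plane} (h : LexLE p q) : p 0 ≤ q 0 := by
  unfold LexLE at h
  grind

/-! ### Points on the upper and on the lower chain -/

theorem height_swap_left (s : Side) (p r q : Plane) : height s q r p = -height s p r q := by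
  cases s <;> simp only [height, cross] <;> ring

theorem height_swap_right (s : Side) (p r q : Plane) : height s p q r = -height s p r q := by
  cases s <;> simp only [height, cross] <;> ring

theorem height_self_left (s : Side) (p r : Plane) : height s p r p = 0 := by
  cases s <;> simp [height, cross]

theorem height_self_right (s : Side) (p r : Plane) : height s p r r = 0 := by
  cases s <;> simp only [height, cross] <;> ring

/-- `q` is on the upper (lower) chain of `S`: it lies strictly above (below) the segment between
any point of `S` that precedes it and any point of `S` that follows it. The condition is void for
the leftmost and for the rightmost point, which are on both chains. -/
def OnChain (S : Set Plane) (s : Side) (q : Plane) : Prop :=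
  ∀ z ∈ S, ∀ w ∈ S, LexLT z q → LexLT q w → 0 < height s z w q

theorem IsLeftmost.onChain {S : Set Plane} {p : Plane} (h : IsLeftmost S p) (s : Side) :
    OnChain S s p :=
  fun z hz _ _ hlt _ => absurd (h.2 z hz) hlt.not_lexLE

theorem IsRightmost.onChain {S : Set Plane} {p : Plane} (h : IsRightmost S p) (s : Side) :
    OnChain S s p :=
  fun _ _ w hw _ hlt => absurd (h.2 w hw) hlt.not_lexLE

/-- The data of a call that remain true throughout the recursion: the end points are points of `S`
on the chain in question, the first one preceding the second one. -/
structure ChainPair (S : Set Plane) (s : Side) (p r : Plane) : Prop where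
  memLeft : p ∈ S
  memRight : r ∈ S
  lt : LexLT p r
  left : OnChain S s p
  right : OnChain S s r

/-- A point of `S` over the line through two points of a chain lies between them: otherwise one of
the two would be hidden below the segment from that point to the other one. -/
theorem ChainPair.between {S : Set Plane} {s : Side} {p r q : Plane} (h : ChainPair S s p r)
    (hq : q ∈ S) (hh : 0 < height s p r q) : LexLT p q ∧ LexLT q r := by
  constructor
  · rcases lexLT_trichotomy p q with hlt | rfl | hlt
    · exact hlt
    · rw [height_self_left] at hh
      exact absurd hh (lt_irrefl _)
    · have := h.left q hq r h.memRight hlt h.lt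
      rw [height_swap_left] at this
      linarith
  · rcases lexLT_trichotomy q r with hlt | rfl | hlt
    · exact hlt
    · rw [height_self_right] at hh
      exact absurd hh (lt_irrefl _)
    · have := h.right p h.memLeft q hq h.lt hlt
      rw [height_swap_right] at this
      linarith

theorem ChainPair.mem_candidates {S : Set Plane} {s : Side} {p r q : Plane}
    (h : ChainPair S s p r) (hq : q ∈ S) (hh : 0 < height s p r q) : q ∈ candidates S s p r :=
  have hb := h.between hq hh
  ⟨hq, hb.1.fst_le, hb.2.fst_le, hh⟩

/-- The segment of a non-leaf call is not vertical. -/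
theorem fst_lt_of_mem_candidates {S : Set Plane} {s : Side} {p r q : Plane}
    (h : q ∈ candidates S s p r) : p 0 < r 0 := by
  obtain ⟨-, h1, h2, h3⟩ := h
  rcases (h1.trans h2).lt_or_eq with hlt | heq
  · exact hlt
  · have h4 : q 0 = p 0 := by linarith
    cases s <;> simp [height, cross, h4, heq] at h3

/-- The pivot beats all points of `S`, not only those of the vertical strip of the call. -/
theorem ChainPair.height_lt_or_eq {S : Set Plane} {s : Side} {p r q : Plane}
    (h : ChainPair S s p r) (hq : IsPivot S s p r q) {z : Plane} (hz : z ∈ S) :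
    height s p r z < height s p r q ∨ (height s p r z = height s p r q ∧ LexLE q z) := by
  rcases lt_or_ge 0 (height s p r z) with hpos | hneg
  · exact hq.2 z (h.mem_candidates hz hpos)
  · exact Or.inl (hneg.trans_lt hq.1.2.2.2)

theorem ChainPair.onChain_pivot {S : Set Plane} {s : Side} {p r q : Plane}
    (h : ChainPair S s p r) (hq : IsPivot S s p r q) : OnChain S s q := by
  intro z hz w hw hzq hqw
  have hu : 0 < r 0 - p 0 := sub_pos.2 (fst_lt_of_mem_candidates hq.1)
  have hz' : height s p r z < height s p r q :=
    (h.height_lt_or_eq hq hz).resolve_right fun hr => hzq.not_lexLE hr.2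
  have hw' : height s p r w ≤ height s p r q := by
    rcases h.height_lt_or_eq hq hw with h' | h'
    · exact h'.le
    · exact h'.1.le
  have key : (r 0 - p 0) * height s z w q =
      (w 0 - q 0) * (height s p r q - height s p r z) +
      (q 0 - z 0) * (height s p r q - height s p r w) := by
    cases s <;> simp only [height, cross] <;> ring
  have hz0 := hzq.fst_le
  have hw0 := hqw.fst_le
  refine pos_of_mul_pos_right (a := r 0 - p 0) ?_ hu.le
  rw [key]
  rcases hqw with hlt | ⟨heq, hlt⟩
  · have := mul_pos (sub_pos.2 hlt) (sub_pos.2 hz')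
    have := mul_nonneg (sub_nonneg.2 hz0) (sub_nonneg.2 hw')
    linarith
  · -- Here `w` is vertically above `q`, which is possible on the lower chain only.
    cases s with
    | upper =>
      have := mul_pos hu (sub_pos.2 hlt)
      simp only [height, cross, heq] at hw'
      linarith
    | lower =>
      have h1 := mul_pos hu (sub_pos.2 hlt)
      have h2 : height .lower p r q - height .lower p r w = (r 0 - p 0) * (w 1 - q 1) := by
        simp only [height, cross, heq]
        ring
      have h3 : z 0 < q 0 := by
        rcases hzq with h' | ⟨h', h''⟩
        · exact h'
        · have := mul_pos hu (sub_pos.2 h'')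
          simp only [height, cross, h'] at hz'
          linarith
      rw [h2, heq, sub_self, zero_mul, zero_add]
      exact mul_pos (by linarith) h1

theorem ChainPair.pivot_left {S : Set Plane} {s : Side} {p r q : Plane}
    (h : ChainPair S s p r) (hq : IsPivot S s p r q) : ChainPair S s p q :=
  ⟨h.memLeft, hq.1.1, (h.between hq.1.1 hq.1.2.2.2).1, h.left, h.onChain_pivot hq⟩

theorem ChainPair.pivot_right {S : Set Plane} {s : Side} {p r q : Plane}
    (h : ChainPair S s p r) (hq : IsPivot S s p r q) : ChainPair S s q r :=
  ⟨hq.1.1, h.memRight, (h.between hq.1.1 hq.1.2.2.2).2, h.onChain_pivot hq, h.right⟩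

/-! ### Vertices of the convex hull -/

/-- A point of `S` that maximizes one linear form, and among the maximizers of this form another,
independent one, is a vertex of the convex hull of `S`. -/
theorem mem_hullVertices_of_lex_max {S : Set Plane} {q : Plane} (hq : q ∈ S) (a b c d : ℝ)
    (hdet : a * d - b * c ≠ 0)
    (hmax : ∀ z ∈ S, a * z 0 + b * z 1 < a * q 0 + b * q 1 ∨
      (a * z 0 + b * z 1 = a * q 0 + b * q 1 ∧ c * z 0 + d * z 1 ≤ c * q 0 + d * q 1)) :
    q ∈ hullVertices S := by
  set K : Set Plane := {z | a * z 0 + b * z 1 < a * q 0 + b * q 1 ∨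
      (a * z 0 + b * z 1 = a * q 0 + b * q 1 ∧ c * z 0 + d * z 1 ≤ c * q 0 + d * q 1)} with hK
  have hconv : Convex ℝ K := by
    intro x hx y hy α β hα hβ hαβ
    simp only [hK, Set.mem_ofPred_eq, PiLp.add_apply, PiLp.smul_apply, smul_eq_mul] at hx hy ⊢
    have hβ' : β = 1 - α := by linarith
    subst hβ'
    rcases hα.eq_or_lt with rfl | hα
    · simpa using hy
    rcases hβ.eq_or_lt with hβ0 | hβ
    · obtain rfl : α = 1 := by linarith
      simpa using hx
    have hx1 : a * x 0 + b * x 1 ≤ a * q 0 + b * q 1 := by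
      rcases hx with h | h
      exacts [h.le, h.1.le]
    have hy1 : a * y 0 + b * y 1 ≤ a * q 0 + b * q 1 := by
      rcases hy with h | h
      exacts [h.le, h.1.le]
    rcases hx with hx | hx
    · left
      nlinarith [mul_lt_mul_of_pos_left hx hα, mul_le_mul_of_nonneg_left hy1 hβ.le]
    rcases hy with hy | hy
    · left
      nlinarith [mul_le_mul_of_nonneg_left hx1 hα.le, mul_lt_mul_of_pos_left hy hβ]
    · right
      constructor
      · linear_combination α * hx.1 + (1 - α) * hy.1
      · nlinarith [mul_le_mul_of_nonneg_left hx.2 hα.le, mul_le_mul_of_nonneg_left hy.2 hβ.le]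
  have hsub : convexHull ℝ S ⊆ K := convexHull_min hmax hconv
  refine ⟨subset_convexHull ℝ S hq, ?_⟩
  rintro x hx y hy ⟨α, β, hα, hβ, hαβ, hxy⟩
  have hx' := hsub hx
  have hy' := hsub hy
  simp only [hK, Set.mem_ofPred_eq] at hx' hy'
  have hq0 : α * x 0 + β * y 0 = q 0 := by simp [← hxy]
  have hq1 : α * x 1 + β * y 1 = q 1 := by simp [← hxy]
  have hβ' : β = 1 - α := by linarith
  subst hβ'
  have hx1 : a * x 0 + b * x 1 ≤ a * q 0 + b * q 1 := by
    rcases hx' with h | h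
    exacts [h.le, h.1.le]
  have hy1 : a * y 0 + b * y 1 ≤ a * q 0 + b * q 1 := by
    rcases hy' with h | h
    exacts [h.le, h.1.le]
  have e1 : a * q 0 + b * q 1 = α * (a * x 0 + b * x 1) + (1 - α) * (a * y 0 + b * y 1) := by
    rw [← hq0, ← hq1]
    ring
  have e2 : c * q 0 + d * q 1 = α * (c * x 0 + d * x 1) + (1 - α) * (c * y 0 + d * y 1) := by
    rw [← hq0, ← hq1]
    ring
  have hx2 : ¬ a * x 0 + b * x 1 < a * q 0 + b * q 1 := fun h => by
    nlinarith [mul_lt_mul_of_pos_left h hα, mul_le_mul_of_nonneg_left hy1 hβ.le]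
  have hy2 : ¬ a * y 0 + b * y 1 < a * q 0 + b * q 1 := fun h => by
    nlinarith [mul_le_mul_of_nonneg_left hx1 hα.le, mul_lt_mul_of_pos_left h hβ]
  have hx3 := hx'.resolve_left hx2
  have hy3 := hy'.resolve_left hy2
  have hx4 : c * x 0 + d * x 1 = c * q 0 + d * q 1 := by
    refine le_antisymm hx3.2 (not_lt.1 fun h => ?_)
    nlinarith [mul_lt_mul_of_pos_left h hα, mul_le_mul_of_nonneg_left hy3.2 hβ.le]
  refine Plane.ext (mul_left_cancel₀ hdet ?_) (mul_left_cancel₀ hdet ?_)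
  · linear_combination d * hx3.1 - b * hx4
  · linear_combination a * hx4 - c * hx3.1

theorem IsLeftmost.mem_hullVertices {S : Set Plane} {p : Plane} (h : IsLeftmost S p) :
    p ∈ hullVertices S := by
  refine mem_hullVertices_of_lex_max h.1 (-1) 0 0 (-1) (by norm_num) fun z hz => ?_
  rcases h.2 z hz with h' | h'
  · left
    linarith
  · right
    constructor <;> linarith [h'.1, h'.2]

theorem IsRightmost.mem_hullVertices {S : Set Plane} {p : Plane} (h : IsRightmost S p) :
    p ∈ hullVertices S := by
  refine mem_hullVertices_of_lex_max h.1 1 0 0 1 (by norm_num) fun z hz => ?_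
  rcases h.2 z hz with h' | h'
  · left
    linarith
  · right
    constructor <;> linarith [h'.1, h'.2]

theorem ChainPair.pivot_mem_hullVertices {S : Set Plane} {s : Side} {p r q : Plane}
    (h : ChainPair S s p r) (hq : IsPivot S s p r q) : q ∈ hullVertices S := by
  have hu : 0 < r 0 - p 0 := sub_pos.2 (fst_lt_of_mem_candidates hq.1)
  have hmax := fun z hz => h.height_lt_or_eq hq (z := z) hz
  cases s with
  | upper =>
    refine mem_hullVertices_of_lex_max hq.1.1 (-(r 1 - p 1)) (r 0 - p 0) (-1) 0
      (by linarith) fun z hz => ?_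
    simp only [height, cross] at hmax
    rcases hmax z hz with h' | ⟨h', hle⟩
    · left
      linarith
    · right
      constructor <;> linarith [hle.fst_le]
  | lower =>
    refine mem_hullVertices_of_lex_max hq.1.1 (r 1 - p 1) (-(r 0 - p 0)) (-1) 0
      (by linarith) fun z hz => ?_
    simp only [height, cross] at hmax
    rcases hmax z hz with h' | ⟨h', hle⟩
    · left
      linarith
    · right
      constructor <;> linarith [hle.fst_le]

/-! ### The recursion -/

theorem exists_isPivot {S : Set Plane} (hS : S.Finite) {s : Side} {p r : Plane}
    (h : candidates S s p r ≠ ∅) : ∃ q, IsPivot S s p r q := by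
  have hfin : (candidates S s p r).Finite := hS.subset fun _ hz => hz.1
  obtain ⟨q, hq, hmin⟩ := Set.exists_min_image (candidates S s p r)
    (fun z => toLex (-height s p r z, toLex (z 0, z 1))) hfin (Set.nonempty_iff_ne_empty.2 h)
  refine ⟨q, hq, fun z hz => ?_⟩
  have := hmin z hz
  simp only [Prod.Lex.toLex_le_toLex] at this
  unfold LexLE
  grind

/-- The recursion terminates, since fewer points of `S` lie between the end points of the
recursive calls. -/
theorem ChainPair.exists_quickHull {S : Set Plane} (hS : S.Finite) {s : Side} {p r : Plane}
    (h : ChainPair S s p r) : ∃ tr, QuickHull S s p r tr := by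
  induction hk : {z ∈ S | LexLT p z ∧ LexLT z r}.ncard using Nat.strong_induction_on
    generalizing p r with
  | _ k ih =>
    by_cases hc : candidates S s p r = ∅
    · exact ⟨_, .leaf p r hc⟩
    · obtain ⟨q, hq⟩ := exists_isPivot hS hc
      have hfin : {z ∈ S | LexLT p z ∧ LexLT z r}.Finite := hS.subset fun _ hz => hz.1
      have hb := h.between hq.1.1 hq.1.2.2.2
      obtain ⟨l₁, h₁⟩ := ih _ (hk ▸ Set.ncard_lt_ncard ⟨fun z hz => ⟨hz.1, hz.2.1,
        hz.2.2.trans hb.2⟩, fun hs => lexLT_irrefl q (hs ⟨hq.1.1, hb⟩).2.2⟩ hfin)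
        (h.pivot_left hq) rfl
      obtain ⟨l₂, h₂⟩ := ih _ (hk ▸ Set.ncard_lt_ncard ⟨fun z hz => ⟨hz.1, hb.1.trans hz.2.1,
        hz.2.2⟩, fun hs => lexLT_irrefl q (hs ⟨hq.1.1, hb⟩).2.1⟩ hfin) (h.pivot_right hq) rfl
      exact ⟨_, .node p r q l₁ l₂ hq h₁ h₂⟩

theorem foundPoints_append (l₁ l₂ : List (Call × Option Plane)) :
    foundPoints (l₁ ++ l₂) = foundPoints l₁ ++ foundPoints l₂ :=
  List.filterMap_append

theorem foundPoints_node (c : Call) (q : Plane) (l₁ l₂ : List (Call × Option Plane)) :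
    foundPoints ((c, some q) :: (l₁ ++ l₂)) = q :: (foundPoints l₁ ++ foundPoints l₂) := by
  rw [← foundPoints_append]
  rfl

/-- The recursion tree is a full binary tree. -/
theorem QuickHull.length_eq {S : Set Plane} {s : Side} {p r : Plane}
    {tr : List (Call × Option Plane)} (h : QuickHull S s p r tr) :
    tr.length = 2 * (foundPoints tr).length + 1 := by
  induction h with
  | leaf p r h => rfl
  | node p r q l₁ l₂ h h₁ h₂ ih₁ ih₂ =>
    rw [foundPoints_node]
    simp only [List.length_cons, List.length_append, ih₁, ih₂]
    ring

theorem QuickHull.found_spec {S : Set Plane} {s : Side} {p r : Plane}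
    {tr : List (Call × Option Plane)} (h : QuickHull S s p r tr) (hpr : ChainPair S s p r) :
    ∀ q ∈ foundPoints tr, q ∈ S ∧ OnChain S s q ∧ q ∈ hullVertices S := by
  induction h with
  | leaf p r h => simp [foundPoints]
  | node p r q l₁ l₂ h h₁ h₂ ih₁ ih₂ =>
    rw [foundPoints_node]
    intro z hz
    rcases List.mem_cons.1 hz with rfl | hz
    · exact ⟨h.1.1, hpr.onChain_pivot h, hpr.pivot_mem_hullVertices h⟩
    rcases List.mem_append.1 hz with hz | hz
    · exact ih₁ (hpr.pivot_left h) z hz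
    · exact ih₂ (hpr.pivot_right h) z hz

/-- For a leaf of the upper recursion, the left end point. -/
def upperLeaf : Call × Option Plane → Option Plane
  | (⟨.upper, p, _⟩, none) => some p
  | _ => none

/-- For a leaf of the lower recursion, the right end point. -/
def lowerLeaf : Call × Option Plane → Option Plane
  | (⟨.lower, _, r⟩, none) => some r
  | _ => none

open Classical in
/-- The vertices of the hull in clockwise order, read off from the leaves of the recursion, whose
segments are the edges of the hull from left to right. Duplicates have to be removed if there is
only one point, which is then both leftmost and rightmost. -/
noncomputable def traceHull (tr : List (Call × Option Plane)) : List Plane :=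
  (tr.filterMap upperLeaf ++ (tr.filterMap lowerLeaf).reverse).dedup

/-- The inner vertices of the chain of a call in lexicographic order, as read off from the
leaves. -/
theorem QuickHull.exists_chain {S : Set Plane} {s : Side} {p r : Plane}
    {tr : List (Call × Option Plane)} (h : QuickHull S s p r tr) (hpr : ChainPair S s p r) :
    ∃ m : List Plane, m.Perm (foundPoints tr) ∧ m.Pairwise LexLT ∧
      (∀ z ∈ m, LexLT p z ∧ LexLT z r) ∧
      (s = .upper → tr.filterMap upperLeaf = p :: m ∧ tr.filterMap lowerLeaf = []) ∧
      (s = .lower → tr.filterMap upperLeaf = [] ∧ tr.filterMap lowerLeaf = m ++ [r]) := by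
  induction h with
  | leaf p r h => exact ⟨[], .refl _, .nil, by simp, by rintro rfl; exact ⟨rfl, rfl⟩,
      by rintro rfl; exact ⟨rfl, rfl⟩⟩
  | node p r q l₁ l₂ h h₁ h₂ ih₁ ih₂ =>
    have hb := hpr.between h.1.1 h.1.2.2.2
    obtain ⟨m₁, hp₁, ho₁, hb₁, hu₁, hl₁⟩ := ih₁ (hpr.pivot_left h)
    obtain ⟨m₂, hp₂, ho₂, hb₂, hu₂, hl₂⟩ := ih₂ (hpr.pivot_right h)
    refine ⟨m₁ ++ q :: m₂, ?_, ?_, ?_, ?_, ?_⟩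
    · rw [foundPoints_node]
      exact List.perm_middle.trans ((hp₁.append hp₂).cons q)
    · refine List.pairwise_append.2 ⟨ho₁, List.pairwise_cons.2 ⟨fun z hz => (hb₂ z hz).1, ho₂⟩, ?_⟩
      intro a ha b hb
      rcases List.mem_cons.1 hb with rfl | hb
      · exact (hb₁ a ha).2
      · exact (hb₁ a ha).2.trans (hb₂ b hb).1
    · intro z hz
      rcases List.mem_append.1 hz with hz | hz
      · exact ⟨(hb₁ z hz).1, (hb₁ z hz).2.trans hb.2⟩
      rcases List.mem_cons.1 hz with rfl | hz
      · exact hb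
      · exact ⟨hb.1.trans (hb₂ z hz).1, (hb₂ z hz).2⟩
    · rintro rfl
      rw [List.filterMap_cons_none rfl, List.filterMap_append, (hu₁ rfl).1, (hu₂ rfl).1,
        List.filterMap_cons_none rfl, List.filterMap_append, (hu₁ rfl).2, (hu₂ rfl).2]
      exact ⟨rfl, rfl⟩
    · rintro rfl
      rw [List.filterMap_cons_none rfl, List.filterMap_append, (hl₁ rfl).1, (hl₂ rfl).1,
        List.filterMap_cons_none rfl, List.filterMap_append, (hl₁ rfl).2, (hl₂ rfl).2]
      exact ⟨rfl, by simp⟩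

/-- The chain covers the points of `S` between its end points: above (below) each of them there is
a point of the convex hull of the chain. -/
theorem QuickHull.exists_above {S : Set Plane} {s : Side} {p r : Plane}
    {tr : List (Call × Option Plane)} (h : QuickHull S s p r tr) (hpr : ChainPair S s p r)
    {z : Plane} (hz : z ∈ S) (hpz : LexLE p z) (hzr : LexLE z r) :
    ∃ w ∈ convexHull ℝ ({p, r} ∪ {q | q ∈ foundPoints tr}), w 0 = z 0 ∧
      (s = .upper → z 1 ≤ w 1) ∧ (s = .lower → w 1 ≤ z 1) := by
  induction h with
  | leaf p r h =>
    have hp : p ∈ convexHull ℝ ({p, r} ∪ {q | q ∈ foundPoints [(⟨s, p, r⟩, none)]}) :=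
      subset_convexHull ℝ _ (by simp)
    have hr : r ∈ convexHull ℝ ({p, r} ∪ {q | q ∈ foundPoints [(⟨s, p, r⟩, none)]}) :=
      subset_convexHull ℝ _ (by simp)
    rcases hpr.lt.fst_le.lt_or_eq with hlt | heq
    · have hu := sub_pos.2 hlt
      have hh : height s p r z ≤ 0 := not_lt.1 fun hh => by
        have := hpr.mem_candidates hz hh
        rw [h] at this
        exact this
      set t : ℝ := (z 0 - p 0) / (r 0 - p 0) with ht
      have htu : t * (r 0 - p 0) = z 0 - p 0 := div_mul_cancel₀ _ hu.ne'
      have h0 : 0 ≤ t := div_nonneg (sub_nonneg.2 hpz.fst_le) hu.le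
      have h1 : t ≤ 1 := (div_le_one hu).2 (by linarith [hzr.fst_le])
      refine ⟨(1 - t) • p + t • r, convex_convexHull ℝ _ hp hr (by linarith) h0 (by ring), ?_, ?_,
        ?_⟩
      · simp only [PiLp.add_apply, PiLp.smul_apply, smul_eq_mul]
        linear_combination htu
      all_goals
        rintro rfl
        simp only [PiLp.add_apply, PiLp.smul_apply, smul_eq_mul]
        simp only [height, cross, ← htu] at hh
        refine le_of_mul_le_mul_left ?_ hu
        linarith
    · -- On a vertical segment the lexicographic order is the order of the second coordinates.
      have h0 : z 0 = p 0 := le_antisymm (heq ▸ hzr.fst_le) hpz.fst_le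
      cases s with
      | upper =>
        refine ⟨r, hr, by rw [h0, heq], fun _ => ?_, by simp⟩
        rcases hzr with h' | h'
        · linarith
        · exact h'.2
      | lower =>
        refine ⟨p, hp, h0.symm, by simp, fun _ => ?_⟩
        rcases hpz with h' | h'
        · linarith
        · exact h'.2
  | node p r q l₁ l₂ h h₁ h₂ ih₁ ih₂ =>
    rw [foundPoints_node]
    have hzq : LexLE z q ∨ LexLE q z := by
      rcases lexLT_trichotomy z q with h' | rfl | h'
      exacts [Or.inl h'.lexLE, Or.inl (lexLE_refl _), Or.inr h'.lexLE]
    rcases hzq with hzq | hzq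
    · obtain ⟨w, hw, hw'⟩ := ih₁ (hpr.pivot_left h) hpz hzq
      refine ⟨w, convexHull_mono ?_ hw, hw'⟩
      rintro x ((rfl | rfl) | hx)
      · simp
      · simp
      · have hx : x ∈ foundPoints l₁ := hx
        simp [hx]
    · obtain ⟨w, hw, hw'⟩ := ih₂ (hpr.pivot_right h) hzq hzr
      refine ⟨w, convexHull_mono ?_ hw, hw'⟩
      rintro x ((rfl | rfl) | hx)
      · simp
      · simp
      · have hx : x ∈ foundPoints l₂ := hx
        simp [hx]

/-! ### The convex hull from the two chains -/

/-- The vertices of the hull are the end points of the two chains and the points found: the convex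
hull of these contains every point `z` of `S`, since `z` lies on a vertical segment between the
two chains. -/
theorem mem_of_mem_hullVertices {S : Set Plane} {pmin pmax : Plane}
    {u l : List (Call × Option Plane)} (hmin : IsLeftmost S pmin) (hmax : IsRightmost S pmax)
    (hu : ChainPair S .upper pmin pmax) (hl : ChainPair S .lower pmin pmax)
    (hqu : QuickHull S .upper pmin pmax u) (hql : QuickHull S .lower pmin pmax l)
    {z : Plane} (hz : z ∈ hullVertices S) :
    z = pmin ∨ z = pmax ∨ z ∈ foundPoints u ∨ z ∈ foundPoints l := by
  set V : Set Plane := {x | x = pmin ∨ x = pmax ∨ x ∈ foundPoints u ∨ x ∈ foundPoints l} with hV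
  have hVS : V ⊆ S := by
    rintro x (rfl | rfl | hx | hx)
    exacts [hmin.1, hmax.1, (hqu.found_spec hu x hx).1, (hql.found_spec hl x hx).1]
  have hSV : S ⊆ convexHull ℝ V := by
    intro x hx
    obtain ⟨a, ha, ha0, ha1, -⟩ := hqu.exists_above hu hx (hmin.2 x hx) (hmax.2 x hx)
    obtain ⟨b, hb, hb0, -, hb1⟩ := hql.exists_above hl hx (hmin.2 x hx) (hmax.2 x hx)
    have ha1 := ha1 rfl
    have hb1 := hb1 rfl
    have ha' : a ∈ convexHull ℝ V := by
      refine convexHull_mono ?_ ha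
      rintro y ((rfl | rfl) | hy)
      exacts [Or.inl rfl, Or.inr (Or.inl rfl), Or.inr (Or.inr (Or.inl hy))]
    have hb' : b ∈ convexHull ℝ V := by
      refine convexHull_mono ?_ hb
      rintro y ((rfl | rfl) | hy)
      exacts [Or.inl rfl, Or.inr (Or.inl rfl), Or.inr (Or.inr (Or.inr hy))]
    rcases (hb1.trans ha1).lt_or_eq with hlt | heq
    · have hd := sub_pos.2 hlt
      set t : ℝ := (x 1 - b 1) / (a 1 - b 1) with ht
      have htu : t * (a 1 - b 1) = x 1 - b 1 := div_mul_cancel₀ _ hd.ne'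
      have h0 : 0 ≤ t := div_nonneg (sub_nonneg.2 hb1) hd.le
      have h1 : t ≤ 1 := (div_le_one hd).2 (by linarith)
      have hx' : x = (1 - t) • b + t • a := by
        apply Plane.ext <;> simp only [PiLp.add_apply, PiLp.smul_apply, smul_eq_mul]
        · rw [ha0, hb0]
          ring
        · linear_combination -htu
      rw [hx']
      exact convex_convexHull ℝ V hb' ha' (by linarith) h0 (by ring)
    · obtain rfl : x = a := Plane.ext ha0.symm (le_antisymm ha1 (heq ▸ hb1))
      exact ha'
  have heq : convexHull ℝ S = convexHull ℝ V :=
    (convexHull_min hSV (convex_convexHull ℝ V)).antisymm (convexHull_mono hVS)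
  rw [hullVertices, heq] at hz
  have hzV : z ∈ V := extremePoints_convexHull_subset hz
  exact hzV

/-- `IsClockwiseHull` from the two chains: an upper chain `U` (with both end points) in
lexicographic order, followed by the inner vertices `L` of the lower chain in the reverse order. -/
theorem isClockwiseHull_of_chains {S : Set Plane} {p : Plane} {U L : List Plane}
    (hp : IsLeftmost S (p : Plane)) (hmem : ∀ z, z ∈ p :: U ++ L ↔ z ∈ hullVertices S)
    (hU : (p :: U).Pairwise LexLT) (hL : L.Pairwise fun a b => LexLT b a)
    (hdisj : ∀ z ∈ p :: U, z ∉ L)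
    (hcu : ∀ z ∈ p :: U, OnChain S .upper z) (hcl : ∀ z ∈ L, OnChain S .lower z) :
    IsClockwiseHull S (p :: U ++ L) := by
  have hS : ∀ z ∈ p :: U ++ L, z ∈ S := fun z hz =>
    extremePoints_convexHull_subset ((hmem z).1 hz)
  set R : Plane → Plane → Prop := fun a b =>
    (a ∈ p :: U ∧ b ∈ p :: U ∧ LexLT a b) ∨ (a ∈ p :: U ∧ b ∈ L) ∨ (a ∈ L ∧ b ∈ L ∧ LexLT b a)
    with hR
  have hpw : (p :: U ++ L).Pairwise R := by
    refine List.pairwise_append.2 ⟨?_, ?_, fun a ha b hb => Or.inr (Or.inl ⟨ha, hb⟩)⟩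
    · exact hU.imp_of_mem fun ha hb h => Or.inl ⟨ha, hb, h⟩
    · exact hL.imp_of_mem fun ha hb h => Or.inr (Or.inr ⟨ha, hb, h⟩)
  refine ⟨hpw.imp ?_, hmem, ⟨p, rfl, hp⟩, ?_⟩
  · rintro a b (⟨-, -, h⟩ | ⟨h, h'⟩ | ⟨-, -, h⟩)
    · exact h.ne
    · rintro rfl
      exact hdisj a h h'
    · exact (LexLT.ne h).symm
  · intro i j k hij hjk
    have h₁ : R ((p :: U ++ L).get i) ((p :: U ++ L).get j) := List.pairwise_iff_get.1 hpw i j hij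
    have h₂ : R ((p :: U ++ L).get j) ((p :: U ++ L).get k) := List.pairwise_iff_get.1 hpw j k hjk
    have ha := hS _ (List.get_mem _ i)
    have hb := hS _ (List.get_mem _ j)
    have hc := hS _ (List.get_mem _ k)
    generalize (p :: U ++ L).get i = a at *
    generalize (p :: U ++ L).get j = b at *
    generalize (p :: U ++ L).get k = c at *
    -- In each case the lexicographically middle one of the three points is above or below the
    -- segment between the other two.
    have up : ∀ x ∈ p :: U, ∀ y ∈ S, ∀ z ∈ S, LexLT y x → LexLT x z → 0 < cross y z x :=
      fun x hx y hy z hz h h' => hcu x hx y hy z hz h h'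
    have lo : ∀ x ∈ L, ∀ y ∈ S, ∀ z ∈ S, LexLT y x → LexLT x z → 0 < -cross y z x :=
      fun x hx y hy z hz h h' => hcl x hx y hy z hz h h'
    rcases h₁ with ⟨haU, hbU, hab⟩ | ⟨haU, hbL⟩ | ⟨haL, hbL, hba⟩
    · rcases h₂ with ⟨-, hcU, hbc⟩ | ⟨-, hcL⟩ | ⟨hbL, -, -⟩
      · have := up b hbU a ha c hc hab hbc
        simp only [cross] at *
        linarith
      · rcases lexLT_trichotomy b c with hbc | rfl | hcb
        · have := up b hbU a ha c hc hab hbc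
          simp only [cross] at *
          linarith
        · exact absurd hcL (hdisj _ hbU)
        rcases lexLT_trichotomy a c with hac | rfl | hca
        · have := lo c hcL a ha b hb hac hcb
          linarith
        · exact absurd hcL (hdisj _ haU)
        · have := up a haU c hc b hb hca hab
          simp only [cross] at *
          linarith
      · exact absurd hbL (hdisj _ hbU)
    · rcases h₂ with ⟨hbU, -, -⟩ | ⟨hbU, -⟩ | ⟨-, hcL, hcb⟩
      · exact absurd hbL (hdisj _ hbU)
      · exact absurd hbL (hdisj _ hbU)
      · rcases lexLT_trichotomy a c with hac | rfl | hca
        · have := lo c hcL a ha b hb hac hcb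
          linarith
        · exact absurd hcL (hdisj _ haU)
        rcases lexLT_trichotomy a b with hab | rfl | hba
        · have := up a haU c hc b hb hca hab
          simp only [cross] at *
          linarith
        · exact absurd hbL (hdisj _ haU)
        · have := lo b hbL c hc a ha hcb hba
          simp only [cross] at *
          linarith
    · rcases h₂ with ⟨hbU, -, -⟩ | ⟨hbU, -⟩ | ⟨-, hcL, hcb⟩
      · exact absurd hbL (hdisj _ hbU)
      · exact absurd hbL (hdisj _ hbU)
      · have := lo b hbL c hc a ha hcb hba
        simp only [cross] at *
        linarith

theorem exists_isLeftmost {S : Set Plane} (hS : S.Finite) (hne : S.Nonempty) :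
    ∃ p, IsLeftmost S p := by
  obtain ⟨p, hp, hmin⟩ := Set.exists_min_image S (fun z => toLex (z 0, z 1)) hS hne
  exact ⟨p, hp, fun z hz => Prod.Lex.toLex_le_toLex.1 (hmin z hz)⟩

theorem exists_isRightmost {S : Set Plane} (hS : S.Finite) (hne : S.Nonempty) :
    ∃ p, IsRightmost S p := by
  obtain ⟨p, hp, hmax⟩ := Set.exists_max_image S (fun z => toLex (z 0, z 1)) hS hne
  exact ⟨p, hp, fun z hz => Prod.Lex.toLex_le_toLex.1 (hmax z hz)⟩

theorem IsLeftmost.unique {S : Set Plane} {p q : Plane} (hp : IsLeftmost S p)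
    (hq : IsLeftmost S q) : p = q :=
  (hp.2 q hq.1).antisymm (hq.2 p hp.1)

theorem IsRightmost.unique {S : Set Plane} {p q : Plane} (hp : IsRightmost S p)
    (hq : IsRightmost S q) : p = q :=
  (hq.2 p hp.1).antisymm (hp.2 q hq.1)

/-- `QuickConvexHull` terminates, its leaves describe the hull, each non-leaf call finds a new
vertex, and the number of calls is linear in the number of vertices. -/
theorem exists_quickConvexHull {S : Set Plane} (hS : S.Finite) (hne : S.Nonempty) :
    ∃ tr, QuickConvexHull S tr ∧ IsClockwiseHull S (traceHull tr) ∧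
      tr.length ≤ 2 * (hullVertices S).ncard ∧ (foundPoints tr).Nodup ∧
      (∀ q ∈ foundPoints tr, q ∈ hullVertices S ∧ ¬ IsLeftmost S q ∧ ¬ IsRightmost S q) ∧
      (∀ z ∈ hullVertices S, z ∈ foundPoints tr ∨ IsLeftmost S z ∨ IsRightmost S z) := by
  classical
  obtain ⟨pmin, hmin⟩ := exists_isLeftmost hS hne
  obtain ⟨pmax, hmax⟩ := exists_isRightmost hS hne
  have hVfin : (hullVertices S).Finite := hS.subset extremePoints_convexHull_subset
  rcases (hmin.2 pmax hmax.1).eq_or_lexLT with rfl | hlt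
  · have hSp : ∀ z ∈ S, z = pmin := fun z hz => (hmax.2 z hz).antisymm (hmin.2 z hz)
    have hc : ∀ s, candidates S s pmin pmin = ∅ := fun s => by
      refine Set.eq_empty_iff_forall_notMem.2 fun z hz => ?_
      have := hz.2.2.2
      rw [hSp z hz.1, height_self_left] at this
      exact lt_irrefl _ this
    have hV : ∀ z ∈ hullVertices S, z = pmin := fun z hz =>
      hSp z (extremePoints_convexHull_subset hz)
    have htr : traceHull [(⟨.upper, pmin, pmin⟩, none), (⟨.lower, pmin, pmin⟩, none)] =
        [pmin] := by
      change List.dedup [pmin, pmin] = [pmin]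
      simp
    refine ⟨[(⟨.upper, pmin, pmin⟩, none), (⟨.lower, pmin, pmin⟩, none)],
      ⟨pmin, pmin, _, _, hmin, hmax, .leaf _ _ (hc _), .leaf _ _ (hc _), rfl⟩, ?_, ?_, ?_, ?_, ?_⟩
    · rw [htr]
      refine ⟨by simp, fun z => ⟨fun hz => ?_, fun hz => by simp [hV z hz]⟩, ⟨pmin, rfl, hmin⟩, ?_⟩
      · rw [List.mem_singleton.1 hz]
        exact hmin.mem_hullVertices
      · intro i j k hij
        exact absurd hij (by simp [Subsingleton.elim (α := Fin 1) i j])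
    · have : 0 < (hullVertices S).ncard := (Set.ncard_pos hVfin).2 ⟨_, hmin.mem_hullVertices⟩
      simp only [List.length_cons, List.length_nil]
      omega
    · simp [foundPoints]
    · simp [foundPoints]
    · intro z hz
      rw [hV z hz]
      exact Or.inr (Or.inl hmin)
  · have hcu : ChainPair S .upper pmin pmax :=
      ⟨hmin.1, hmax.1, hlt, hmin.onChain _, hmax.onChain _⟩
    have hcl : ChainPair S .lower pmin pmax :=
      ⟨hmin.1, hmax.1, hlt, hmin.onChain _, hmax.onChain _⟩
    obtain ⟨u, hu⟩ := hcu.exists_quickHull hS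
    obtain ⟨l, hl⟩ := hcl.exists_quickHull hS
    obtain ⟨mu, hpu, hou, hbu, hfu, -⟩ := hu.exists_chain hcu
    obtain ⟨ml, hpl, hol, hbl, -, hfl⟩ := hl.exists_chain hcl
    obtain ⟨hfu₁, hfu₂⟩ := hfu rfl
    obtain ⟨hfl₁, hfl₂⟩ := hfl rfl
    have su := hu.found_spec hcu
    have sl := hl.found_spec hcl
    have hbetween : ∀ q ∈ foundPoints (u ++ l), LexLT pmin q ∧ LexLT q pmax := by
      intro q hq
      rw [foundPoints_append] at hq
      rcases List.mem_append.1 hq with hq | hq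
      exacts [hbu q (hpu.mem_iff.2 hq), hbl q (hpl.mem_iff.2 hq)]
    -- A point on both chains would be above and below the segment from `pmin` to `pmax`.
    have hdisj : ∀ q ∈ foundPoints u, q ∉ foundPoints l := by
      intro q hqu hql
      have hb := hbu q (hpu.mem_iff.2 hqu)
      have h1 := (su q hqu).2.1 pmin hmin.1 pmax hmax.1 hb.1 hb.2
      have h2 := (sl q hql).2.1 pmin hmin.1 pmax hmax.1 hb.1 hb.2
      simp only [height] at h1 h2
      linarith
    have hnodup : ∀ {m : List Plane}, m.Pairwise LexLT → m.Nodup := fun h =>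
      h.imp fun hab => hab.ne
    have hfnodup : (foundPoints (u ++ l)).Nodup := by
      rw [foundPoints_append]
      exact List.nodup_append'.2 ⟨hpu.nodup_iff.1 (hnodup hou), hpl.nodup_iff.1 (hnodup hol), hdisj⟩
    have hfound : ∀ q ∈ foundPoints (u ++ l), q ∈ hullVertices S := by
      intro q hq
      rw [foundPoints_append] at hq
      rcases List.mem_append.1 hq with hq | hq
      exacts [(su q hq).2.2, (sl q hq).2.2]
    have hhull : IsClockwiseHull S (pmin :: (mu ++ [pmax]) ++ ml.reverse) := by
      refine isClockwiseHull_of_chains hmin ?_ ?_ ?_ ?_ ?_ ?_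
      · intro z
        simp only [List.cons_append, List.append_assoc, List.mem_cons, List.mem_append,
          List.mem_reverse, List.not_mem_nil, false_or, hpu.mem_iff, hpl.mem_iff]
        constructor
        · rintro (rfl | hz | rfl | hz)
          exacts [hmin.mem_hullVertices, (su z hz).2.2, hmax.mem_hullVertices, (sl z hz).2.2]
        · intro hz
          have := mem_of_mem_hullVertices hmin hmax hcu hcl hu hl hz
          tauto
      · refine List.pairwise_cons.2 ⟨fun z hz => ?_, List.pairwise_append.2 ⟨hou,
          List.pairwise_singleton _ _, fun a ha b hb => ?_⟩⟩
        · rcases List.mem_append.1 hz with hz | hz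
          · exact (hbu z hz).1
          · rwa [List.mem_singleton.1 hz]
        · rw [List.mem_singleton.1 hb]
          exact (hbu a ha).2
      · exact List.pairwise_reverse.2 hol
      · intro z hz hz'
        rw [List.mem_reverse] at hz'
        rcases List.mem_cons.1 hz with rfl | hz
        · exact lexLT_irrefl _ (hbl z hz').1
        rcases List.mem_append.1 hz with hz | hz
        · exact hdisj z (hpu.mem_iff.1 hz) (hpl.mem_iff.1 hz')
        · rw [List.mem_singleton.1 hz] at hz'
          exact lexLT_irrefl _ (hbl _ hz').2
      · intro z hz
        rcases List.mem_cons.1 hz with rfl | hz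
        · exact hmin.onChain _
        rcases List.mem_append.1 hz with hz | hz
        · exact (su z (hpu.mem_iff.1 hz)).2.1
        · rw [List.mem_singleton.1 hz]
          exact hmax.onChain _
      · intro z hz
        exact (sl z (hpl.mem_iff.1 (List.mem_reverse.1 hz))).2.1
    refine ⟨u ++ l, ⟨pmin, pmax, u, l, hmin, hmax, hu, hl, rfl⟩, ?_, ?_, hfnodup, ?_, ?_⟩
    · have : traceHull (u ++ l) = (pmin :: (mu ++ [pmax]) ++ ml.reverse).dedup := by
        simp [traceHull, List.filterMap_append, hfu₁, hfu₂, hfl₁, hfl₂]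
      rw [this, List.Nodup.dedup hhull.1]
      exact hhull
    · have hn : (pmin :: foundPoints (u ++ l)).Nodup :=
        List.nodup_cons.2 ⟨fun h => lexLT_irrefl _ (hbetween _ h).1, hfnodup⟩
      have hsub : ((pmin :: foundPoints (u ++ l)).toFinset : Set Plane) ⊆ hullVertices S := by
        intro z hz
        rw [Finset.mem_coe, List.mem_toFinset] at hz
        rcases List.mem_cons.1 hz with rfl | hz
        exacts [hmin.mem_hullVertices, hfound z hz]
      have hcard := Set.ncard_le_ncard hsub hVfin
      rw [Set.ncard_coe_finset, List.toFinset_card_of_nodup hn, List.length_cons,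
        foundPoints_append, List.length_append] at hcard
      rw [List.length_append, hu.length_eq, hl.length_eq]
      omega
    · exact fun q hq => ⟨hfound q hq, fun h => (hbetween q hq).1.ne (hmin.unique h),
        fun h => (hbetween q hq).2.ne (h.unique hmax)⟩
    · intro z hz
      rw [foundPoints_append, List.mem_append]
      rcases mem_of_mem_hullVertices hmin hmax hcu hcl hu hl hz with rfl | rfl | h | h
      exacts [Or.inr (Or.inl hmin), Or.inr (Or.inr hmax), Or.inl (Or.inl h), Or.inl (Or.inr h)]

/-! ### Selection of a best point by one round of broadcasts -/

/-- A query asks for the point of smallest key among the points with some property. -/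
structure Query where
  cand : Set Plane
  key : Plane → ℝ ×ₗ (ℝ ×ₗ ℝ)
  key_injective : Function.Injective key

namespace Query

/-- `q` is the answer to the query on the point set `S`. -/
def IsBest (Q : Query) (S : Set Plane) (q : Plane) : Prop :=
  q ∈ S ∧ q ∈ Q.cand ∧ ∀ z ∈ S, z ∈ Q.cand → Q.key q ≤ Q.key z

open Classical in
/-- The answer to the query on the point set `S`, which is `none` if `S` has no candidate. -/
noncomputable def answer (Q : Query) (S : Set Plane) : Option Plane :=
  if h : ∃ q, Q.IsBest S q then some h.choose else none

theorem IsBest.unique {Q : Query} {S : Set Plane} {p q : Plane} (hp : Q.IsBest S p)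
    (hq : Q.IsBest S q) : p = q :=
  Q.key_injective ((hp.2.2 q hq.1 hq.2.1).antisymm (hq.2.2 p hp.1 hp.2.1))

theorem answer_eq_some_iff {Q : Query} {S : Set Plane} {q : Plane} :
    Q.answer S = some q ↔ Q.IsBest S q := by
  unfold answer
  split_ifs with h
  · constructor
    · intro h'
      rw [← Option.some.inj h']
      exact h.choose_spec
    · intro h'
      rw [h.choose_spec.unique h']
  · exact ⟨fun h' => by simp at h', fun h' => absurd ⟨q, h'⟩ h⟩

theorem answer_eq_none {Q : Query} {S : Set Plane} (h : ∀ z ∈ S, z ∉ Q.cand) :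
    Q.answer S = none :=
  Option.eq_none_iff_forall_ne_some.2 fun q hq =>
    have hb := answer_eq_some_iff.1 hq
    h q hb.1 hb.2.1

theorem exists_isBest {Q : Query} {S : Set Plane} (hS : S.Finite) {z : Plane} (hz : z ∈ S)
    (hz' : z ∈ Q.cand) : ∃ q, Q.IsBest S q := by
  obtain ⟨q, hq, hmin⟩ := Set.exists_min_image (S ∩ Q.cand) Q.key (hS.subset fun _ h => h.1)
    ⟨z, hz, hz'⟩
  exact ⟨q, hq.1, hq.2, fun y hy hy' => hmin y ⟨hy, hy'⟩⟩

/-- The best point of a union is the best one of the best points of its parts. -/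
theorem answer_iUnion {ι : Type*} (Q : Query) (B : ι → Set Plane) (hB : ∀ v, (B v).Finite) :
    Q.answer {x | ∃ v, Q.answer (B v) = some x} = Q.answer {x | ∃ v, x ∈ B v} := by
  refine Option.ext fun q => answer_eq_some_iff.trans (Iff.trans ?_ answer_eq_some_iff.symm)
  constructor
  · rintro ⟨⟨v, hv⟩, hq, hmin⟩
    refine ⟨⟨v, (answer_eq_some_iff.1 hv).1⟩, hq, ?_⟩
    rintro z ⟨w, hz⟩ hz'
    obtain ⟨y, hy⟩ := exists_isBest (hB w) hz hz'
    exact (hmin y ⟨w, answer_eq_some_iff.2 hy⟩ hy.2.1).trans (hy.2.2 z hz hz')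
  · rintro ⟨⟨v, hv⟩, hq, hmin⟩
    refine ⟨⟨v, answer_eq_some_iff.2 ⟨hv, hq, fun z hz hz' => hmin z ⟨v, hz⟩ hz'⟩⟩, hq, ?_⟩
    rintro z ⟨w, hz⟩ hz'
    exact hmin z ⟨w, (answer_eq_some_iff.1 hz).1⟩ hz'

/-- The query for the leftmost point. -/
def leftmost : Query where
  cand := Set.univ
  key z := toLex (0, toLex (z 0, z 1))
  key_injective z w h := by
    simp only [EmbeddingLike.apply_eq_iff_eq, Prod.mk.injEq, true_and] at h
    exact Plane.ext h.1 h.2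

/-- The query for the rightmost point. -/
def rightmost : Query where
  cand := Set.univ
  key z := toLex (0, toLex (-z 0, -z 1))
  key_injective z w h := by
    simp only [EmbeddingLike.apply_eq_iff_eq, Prod.mk.injEq, true_and, neg_inj] at h
    exact Plane.ext h.1 h.2

/-- The query for the pivot of a call. -/
def pivot (c : Call) : Query where
  cand := candidates Set.univ c.side c.p c.r
  key z := toLex (-height c.side c.p c.r z, toLex (z 0, z 1))
  key_injective z w h := by
    simp only [EmbeddingLike.apply_eq_iff_eq, Prod.mk.injEq] at h
    exact Plane.ext h.2.1 h.2.2

theorem answer_leftmost {S : Set Plane} {p : Plane} (h : IsLeftmost S p) :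
    leftmost.answer S = some p := by
  refine answer_eq_some_iff.2 ⟨h.1, trivial, fun z hz _ => ?_⟩
  have := h.2 z hz
  simp only [leftmost, Prod.Lex.toLex_le_toLex]
  exact Or.inr ⟨trivial, this⟩

theorem answer_rightmost {S : Set Plane} {p : Plane} (h : IsRightmost S p) :
    rightmost.answer S = some p := by
  refine answer_eq_some_iff.2 ⟨h.1, trivial, fun z hz _ => ?_⟩
  have := h.2 z hz
  simp only [rightmost, Prod.Lex.toLex_le_toLex]
  refine Or.inr ⟨trivial, ?_⟩
  unfold LexLE at this
  grind

theorem answer_pivot_of_isPivot {S : Set Plane} {s : Side} {p r q : Plane}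
    (h : IsPivot S s p r q) : (pivot ⟨s, p, r⟩).answer S = some q := by
  refine answer_eq_some_iff.2 ⟨h.1.1, ⟨trivial, h.1.2⟩, fun z hz hz' => ?_⟩
  have := h.2 z ⟨hz, hz'.2⟩
  simp only [pivot, Prod.Lex.toLex_le_toLex]
  unfold LexLE at this
  grind

theorem answer_pivot_of_leaf {S : Set Plane} {s : Side} {p r : Plane}
    (h : candidates S s p r = ∅) : (pivot ⟨s, p, r⟩).answer S = none :=
  answer_eq_none fun z hz hz' =>
    Set.eq_empty_iff_forall_notMem.1 h z ⟨hz, hz'.2⟩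

end Query

/-! ### The recursion as a sequence of queries -/

/-- The stage of the computation, which is known to all nodes: nothing is known, or the leftmost
point only, or else the calls not executed yet (the current one first) and the trace of those
executed so far. -/
inductive Phase where
  | start
  | foundLeft (pmin : Plane)
  | calls (stack : List Call) (tr : List (Call × Option Plane))

namespace Phase

/-- The query to be answered next. No query is needed once the stack is empty, and then the one
given here has no effect. -/
def query : Phase → Query
  | start => .leftmost
  | foundLeft _ => .rightmost
  | calls [] _ => .leftmost
  | calls (c :: _) _ => .pivot c

/-- The effect of the answer to the current query. -/
def step : Phase → Option Plane → Phase
  | start, some p => foundLeft p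
  | start, none => start
  | foundLeft p, some r => calls [⟨.upper, p, r⟩, ⟨.lower, p, r⟩] []
  | foundLeft p, none => foundLeft p
  | calls [] tr, _ => calls [] tr
  | calls (c :: st) tr, none => calls st (tr ++ [(c, none)])
  | calls (c :: st) tr, some q =>
    calls (⟨c.side, c.p, q⟩ :: ⟨c.side, q, c.r⟩ :: st) (tr ++ [(c, some q)])

/-- The call being executed. -/
def active : Phase → Option Call
  | calls (c :: _) _ => some c
  | _ => none

/-- The hull, once all calls are executed. -/
noncomputable def result : Phase → Option (List Plane)
  | calls [] tr => some (traceHull tr)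
  | _ => none

theorem result_eq_none {φ : Phase} {c : Call} (h : φ.active = some c) : φ.result = none := by
  match φ, h with
  | calls (_ :: _) _, _ => rfl

/-- The phase after one more query on the point set `S`. -/
noncomputable def next (S : Set Plane) (φ : Phase) : Phase := φ.step (φ.query.answer S)

/-- Starting from phase `φ`, the calls executed one after the other are those of `tr`, and the
phase after the last one is `φ'`. -/
def Executes (S : Set Plane) : Phase → List (Call × Option Plane) → Phase → Prop
  | φ, [], φ' => φ = φ'
  | φ, e :: tr, φ' => φ.active = some e.1 ∧ Executes S (φ.next S) tr φ'

theorem Executes.append {S : Set Plane} {φ φ' φ'' : Phase} {l₁ l₂ : List (Call × Option Plane)}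
    (h₁ : Executes S φ l₁ φ') (h₂ : Executes S φ' l₂ φ'') : Executes S φ (l₁ ++ l₂) φ'' := by
  induction l₁ generalizing φ with
  | nil =>
    obtain rfl : φ = φ' := h₁
    exact h₂
  | cons e l ih => exact ⟨h₁.1, ih h₁.2⟩

theorem Executes.iterate {S : Set Plane} {φ φ' : Phase} {tr : List (Call × Option Plane)}
    (h : Executes S φ tr φ') :
    (∀ i : Fin tr.length, ((next S)^[i] φ).active = some (tr.get i).1) ∧
      (next S)^[tr.length] φ = φ' := by
  induction tr generalizing φ with
  | nil => exact ⟨fun i => i.elim0, h⟩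
  | cons e l ih =>
    obtain ⟨h₁, h₂⟩ := ih h.2
    refine ⟨fun i => ?_, h₂⟩
    refine Fin.cases ?_ (fun j => ?_) i
    · exact h.1
    · exact h₁ j

/-- The queries follow the recursion. -/
theorem executes_of_quickHull {S : Set Plane} {s : Side} {p r : Plane}
    {tr : List (Call × Option Plane)} (h : QuickHull S s p r tr) (st : List Call)
    (tr₀ : List (Call × Option Plane)) :
    Executes S (calls (⟨s, p, r⟩ :: st) tr₀) tr (calls st (tr₀ ++ tr)) := by
  induction h generalizing st tr₀ with
  | leaf p r h =>
    refine ⟨rfl, ?_⟩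
    simp only [next, query, Query.answer_pivot_of_leaf h, step, Executes]
  | node p r q l₁ l₂ h h₁ h₂ ih₁ ih₂ =>
    refine ⟨rfl, ?_⟩
    simp only [next, query, Query.answer_pivot_of_isPivot h, step]
    refine (ih₁ _ _).append ?_
    convert ih₂ st (tr₀ ++ [(⟨s, p, r⟩, some q)] ++ l₁) using 2
    simp

theorem iterate_next_done (S : Set Plane) (tr : List (Call × Option Plane)) (t : ℕ) :
    (next S)^[t] (calls [] tr) = calls [] tr :=
  Function.iterate_fixed rfl t

/-- Two queries find the leftmost and the rightmost point, and then each query executes one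
call. -/
theorem iterate_next_of_quickConvexHull {S : Set Plane} {tr : List (Call × Option Plane)}
    (h : QuickConvexHull S tr) :
    (∀ t < 2, ((next S)^[t] start).active = none ∧ ((next S)^[t] start).result = none) ∧
      (∀ i : Fin tr.length, ((next S)^[2 + i] start).active = some (tr.get i).1) ∧
      ∀ t, 2 + tr.length ≤ t → (next S)^[t] start = calls [] tr := by
  obtain ⟨pmin, pmax, u, l, hmin, hmax, hu, hl, rfl⟩ := h
  have h1 : next S start = foundLeft pmin := by
    simp only [next, query, Query.answer_leftmost hmin, step]
  have h2 : next S (foundLeft pmin) = calls [⟨.upper, pmin, pmax⟩, ⟨.lower, pmin, pmax⟩] [] := by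
    simp only [next, query, Query.answer_rightmost hmax, step]
  have h3 (t : ℕ) : (next S)^[2 + t] start =
      (next S)^[t] (calls [⟨.upper, pmin, pmax⟩, ⟨.lower, pmin, pmax⟩] []) := by
    rw [add_comm, Function.iterate_add_apply]
    simp only [Function.iterate_succ_apply, Function.iterate_zero_apply, h1, h2]
  obtain ⟨h4, h5⟩ := ((executes_of_quickHull hu _ _).append
    (executes_of_quickHull hl _ _)).iterate
  refine ⟨fun t ht => ?_, fun i => ?_, fun t ht => ?_⟩
  · interval_cases t
    · exact ⟨rfl, rfl⟩
    · rw [Function.iterate_one, h1]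
      exact ⟨rfl, rfl⟩
  · rw [h3]
    exact h4 i
  · obtain ⟨k, rfl⟩ := Nat.exists_eq_add_of_le ht
    rw [add_assoc, h3, add_comm, Function.iterate_add_apply, h5]
    exact iterate_next_done S _ k

end Phase

/-! ### The distributed algorithm -/

section Distributed

variable {n b B : ℕ}

/-- The point whose coordinates are given by two words. -/
def wordPoint (val : Word b → ℝ) (w : Word b × Word b) : Plane := !₂[val w.1, val w.2]

/-- The set of points of a batch. -/
def batchSet (val : Word b → ℝ) (batch : Batch n b) : Set Plane :=
  Set.range fun j => wordPoint val (batch j)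

theorem exists_localAnswer (val : Word b → ℝ) (batch : Batch n b) (Q : Query) :
    ∃ w : Option (Word b × Word b), w.map (wordPoint val) = Q.answer (batchSet val batch) := by
  cases h : Q.answer (batchSet val batch) with
  | none => exact ⟨none, rfl⟩
  | some q =>
    obtain ⟨j, hj⟩ := (Query.answer_eq_some_iff.1 h).1
    exact ⟨some (batch j), congrArg some hj⟩

/-- The two words of the best point of a batch. -/
noncomputable def localAnswer (val : Word b → ℝ) (batch : Batch n b) (Q : Query) :
    Option (Word b × Word b) :=
  (exists_localAnswer val batch Q).choose

theorem map_localAnswer (val : Word b → ℝ) (batch : Batch n b) (Q : Query) :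
    (localAnswer val batch Q).map (wordPoint val) = Q.answer (batchSet val batch) :=
  (exists_localAnswer val batch Q).choose_spec

/-- In each round, each node sends to all nodes the best point of its batch for the current query,
encoded by `e` as a word of `B` bits, and finds the answer to the query among the points
received. -/
noncomputable def quickHullAlgorithm (n : ℕ) (val : Word b → ℝ)
    (e : Option (Word b × Word b) ↪ Word B) : CliqueAlgorithm n B (Batch n b) (List Plane) where
  State := Batch n b × Phase
  init _ batch := (batch, .start)
  send _ σ _ := e (localAnswer val σ.1 σ.2.query)
  update _ σ msg := (σ.1, σ.2.step (σ.2.query.answer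
    {x | ∃ u, (Function.invFun e (msg u)).map (wordPoint val) = some x}))
  output v σ := σ.2.result.map fun hull => inBatches n hull v

/-- All nodes go through the phases of the computation on the whole point set. -/
theorem run_quickHullAlgorithm (val : Word b → ℝ) (e : Option (Word b × Word b) ↪ Word B)
    (inp : Fin n → Batch n b) (t : ℕ) (v : Fin n) :
    (quickHullAlgorithm n val e).run inp t v =
      (inp v, (Phase.next (inputSet val inp))^[t] .start) := by
  induction t generalizing v with
  | zero => rfl
  | succ t ih =>
    rw [Function.iterate_succ_apply', CliqueAlgorithm.run]
    simp only [ih]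
    simp only [quickHullAlgorithm, Function.leftInverse_invFun e.injective _, map_localAnswer]
    rw [Query.answer_iUnion _ (fun u => batchSet val (inp u)) fun u => Set.finite_range _]
    have : {x | ∃ u, x ∈ batchSet val (inp u)} = inputSet val inp := by
      ext x
      exact exists_congr fun u => exists_congr fun j => eq_comm
    rw [this]
    rfl

theorem finite_inputSet (val : Word b → ℝ) (inp : Fin n → Batch n b) :
    (inputSet val inp).Finite := by
  refine (Set.finite_range fun x : Fin n × Fin n => inputPoint val inp x.1 x.2).subset ?_
  rintro _ ⟨v, j, rfl⟩
  exact ⟨(v, j), rfl⟩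

/-- One bit more than two coordinates have is enough for an optional point. -/
theorem nonempty_optionalPoint_embedding (h : 2 * b + 1 ≤ B) :
    Nonempty (Option (Word b × Word b) ↪ Word B) := by
  refine Function.Embedding.nonempty_of_card_le ?_
  simp only [Fintype.card_option, Fintype.card_prod, Fintype.card_fun, Fintype.card_bool,
    Fintype.card_fin]
  calc 2 ^ b * 2 ^ b + 1 ≤ 2 ^ b * 2 ^ b + 2 ^ b * 2 ^ b :=
        Nat.add_le_add_left (Nat.mul_pos (by positivity) (by positivity)) _
    _ = 2 ^ (2 * b + 1) := by ring
    _ ≤ 2 ^ B := Nat.pow_le_pow_right (by norm_num) h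

end Distributed

/-- For coordinates of `c * bitLength n` bits there are constants `d` (message size) and `C`, which
depend on `c` only, such that `QuickConvexHull` can be implemented on the congested `n`-clique
with messages of `d * bitLength n` bits: it computes the convex hull of the `n ^ 2` input points
in at most `C * h` rounds, where `h` is the number of vertices of the hull, it spends at most `C`
rounds on each call, and each non-leaf call finds a new vertex of the hull. -/
theorem theorem1 (c : ℕ) :
    ∃ d C : ℕ, ∀ n : ℕ, 1 ≤ n → ∀ val : Word (c * bitLength n) → ℝ,
      ∃ (A : CliqueAlgorithm n (d * bitLength n) (Batch n (c * bitLength n)) (List Plane))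
        (active : Fin n → A.State → Option Call),
        ∀ inp : Fin n → Batch n (c * bitLength n),
          (∀ v j v' j', inputPoint val inp v j = inputPoint val inp v' j' → v = v' ∧ j = j') →
          ∃ (hull : List Plane) (tr : List (Call × Option Plane)),
            IsClockwiseHull (inputSet val inp) hull ∧
            A.ComputesIn inp (C * (hullVertices (inputSet val inp)).ncard) (inBatches n hull) ∧
            QuickConvexHull (inputSet val inp) tr ∧
            ExecutesCalls A active inp C tr (inBatches n hull) ∧
            (foundPoints tr).Nodup ∧
            (∀ q ∈ foundPoints tr, q ∈ hullVertices (inputSet val inp) ∧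
              ¬ IsLeftmost (inputSet val inp) q ∧ ¬ IsRightmost (inputSet val inp) q) ∧
            (∀ z ∈ hullVertices (inputSet val inp), z ∈ foundPoints tr ∨
              IsLeftmost (inputSet val inp) z ∨ IsRightmost (inputSet val inp) z) := by
  -- With `h` vertices there are at most `2 * h` calls, hence `2 + 2 * h ≤ 4 * h` rounds.
  refine ⟨2 * c + 1, 4, fun n hn val => ?_⟩
  obtain ⟨e⟩ : Nonempty (Option (Word (c * bitLength n) × Word (c * bitLength n)) ↪
      Word ((2 * c + 1) * bitLength n)) := by
    refine nonempty_optionalPoint_embedding ?_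
    have : 1 ≤ bitLength n := Nat.le_add_left _ _
    linarith
  refine ⟨quickHullAlgorithm n val e, fun _ (σ : Batch n _ × Phase) => σ.2.active,
    fun inp _ => ?_⟩
  have hne : (inputSet val inp).Nonempty := ⟨_, ⟨0, hn⟩, ⟨0, hn⟩, rfl⟩
  obtain ⟨tr, htr, hhull, hlen, hnodup, hfound, hall⟩ :=
    exists_quickConvexHull (finite_inputSet val inp) hne
  obtain ⟨hstart, hcalls, hdone⟩ := Phase.iterate_next_of_quickConvexHull htr
  have hcard : 1 ≤ (hullVertices (inputSet val inp)).ncard := by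
    have : 0 < tr.length := by
      obtain ⟨pmin, pmax, u, l, -, -, hu, -, rfl⟩ := htr
      rw [List.length_append, hu.length_eq]
      omega
    omega
  have hcomp : ∀ R, 2 + tr.length ≤ R → (quickHullAlgorithm n val e).ComputesIn inp R
      (inBatches n (traceHull tr)) := by
    intro R hR v
    refine ⟨2 + tr.length, hR, fun s hs => ?_, fun s hs => ?_⟩
    · rw [run_quickHullAlgorithm]
      have : ((Phase.next (inputSet val inp))^[s] .start).result = none := by
        rcases lt_or_ge s 2 with h | h
        · exact (hstart s h).2
        · obtain ⟨i, rfl⟩ := Nat.exists_eq_add_of_le h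
          exact Phase.result_eq_none (hcalls ⟨i, by omega⟩)
      simp only [quickHullAlgorithm, this, Option.map_none]
    · rw [run_quickHullAlgorithm, hdone s hs]
      rfl
  refine ⟨traceHull tr, tr, hhull, hcomp _ (by omega), htr, ⟨fun i => 2 + i, by norm_num,
    fun i _ => ⟨by simp, by simp only; omega⟩, fun t ht v => ?_, fun i t ht ht' v => ?_,
    fun t ht v => ?_, hcomp _ (by simp)⟩, hnodup, hfound, hall⟩
  · rw [run_quickHullAlgorithm]
    exact (hstart t ht).1
  · rw [run_quickHullAlgorithm]
    obtain rfl : t = 2 + i := by simp only at ht ht'; omega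
    exact hcalls i
  · rw [run_quickHullAlgorithm]
    simp only [hdone t ht, Phase.active]
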